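/- Let $K$ be a field of characteristic zero, let $L/K$ be a finite (hence separable) extension of fields, let $E$ be the Galois closure of $L/K$, and put $G=\mathrm{Gal}(E/K)$, $G_L=\mathrm{Gal}(E/L)$ and $X=G/G_L$ (left cosets). Let $\lambda:G\to\mathrm{Perm}(X)$ be given by $\lambda(\sigma)(\tau G_L)=\sigma\tau G_L$, and let $G$ act on $\mathrm{Perm}(X)$ by $\sigma*\eta=\lambda(\sigma)\,\eta\,\lambda(\sigma)^{-1}$. Let $N$ be an abelian group and, for $i=1,2$, let $\alpha_i:N\to\mathrm{Perm}(X)$ be an injective homomorphism whose image is $G$-stable and regular (that is, $|\alpha_i(N)|=|X|$ and $\alpha_i(N)$ acts transitively on $X$). Let $E[\alpha_i(N)]^G$ be the $K$-algebra of fixed points of the group algebra $E[\alpha_i(N)]$ under the simultaneous action of $G$ on $E$ as Galois automorphisms and on $\alpha_i(N)$ by $*$. Let $\mathrm{Hol}(N)$ be the normalizer in $\mathrm{Perm}(N)$ of the group of left translations of $N$; then $\mathrm{Hol}(N)=\rho(N)\rtimes\mathrm{Aut}(N)$, where $\rho(x)[y]=yx^{-1}$. Let $\beta_i:G\to\mathrm{Hol}(N)$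 be the homomorphism corresponding to $\alpha_i$ under Byott's translation, that is, $\beta_i(g)=a_i^{-1}\lambda(g)a_i$, where $a_i:N\to X$ is the bijection $a_i(\eta)=\alpha_i(\eta)(1\cdot G_L)$. Let $\overline{\beta_i}:G\to\mathrm{Aut}(N)$ be the composition of $\beta_i$ with the projection of $\mathrm{Hol}(N)$ onto $\mathrm{Aut}(N)$. Let $\zeta$ be a primitive $e$-th root of unity, where $e$ is the exponent of $N$, let $\tilde E$ be the compositum of $E$ and $K(\zeta)$, and let $\Gamma=\mathrm{Gal}(\tilde E/K)$. For $i=1,2$ let $\Gamma$ act on $N$ by $\gamma*_i\eta=\overline{\beta_i}(\gamma|_E)[\eta]$, and on the dual group $\widehat N=\mathrm{Hom}(N,\tilde E^\times)$ by $(\gamma*_i\chi)[\eta]=\gamma\bigl(\chi[\gamma^{-1}*_i\eta]\bigr)$. Then $E[\alpha_1(N)]^G\cong E[\alpha_2(N)]^G$ as $K$-algebras if and only if $(\widehat N,*_1)\cong(\widehat N,*_2)$ as $\Gamma$-sets, i.e. if and only if there is a bijection $\psi:\widehat N\to\widehat N$ with $\psi(\gamma*_1\chi)=\gamma*_2\psi(\chi)$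 for all $\gamma\in\Gamma$ and $\chi\in\widehat N$. -/

import Mathlib

noncomputable section

namespace HopfGalois

open Equiv

/-! ### Regular stable embeddings and Byott's translation -/

/-- The action of `G` on the left coset space `X = G ⧸ H` by left translation,
`σ ↦ (τH ↦ στH)`. -/
def cosetTranslation (G : Type*) [Group G] (H : Subgroup G) : G →* Perm (G ⧸ H) :=
  MulAction.toPermHom G (G ⧸ H)

/-- The left regular representation `x ↦ (y ↦ x * y)`. -/
def leftReg (N : Type*) [Group N] : N →* Perm N :=
  MulAction.toPermHom N N

/-- The right regular representation `x ↦ (y ↦ y * x⁻¹)`. -/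
def rightReg (N : Type*) [Group N] : N →* Perm N where
  toFun x := Equiv.mulRight x⁻¹
  map_one' := by ext y; simp
  map_mul' a b := by ext y; simp [mul_assoc]

/-- A subgroup of `Perm X` is regular if it has the same size as `X` and acts transitively
on `X`. (Used only for finite `X`.) -/
def IsRegularSubgroup {X : Type*} (P : Subgroup (Perm X)) : Prop :=
  Nat.card P = Nat.card X ∧ MulAction.IsPretransitive P X

/-- An embedding of `N` into `Perm (G ⧸ H)` whose image is regular and normalized by the
left translations by elements of `G`. -/
structure RegularStableEmbedding (G : Type*) [Group G] (H : Subgroup G)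
    (N : Type*) [Group N] where
  /-- the underlying homomorphism -/
  hom : N →* Perm (G ⧸ H)
  injective : Function.Injective hom
  regular : IsRegularSubgroup hom.range
  stable : (cosetTranslation G H).range ≤ Subgroup.normalizer (hom.range : Set (Perm (G ⧸ H)))

/-- The holomorph of `N`: the normalizer of the left translations in `Perm N`. -/
def Hol (N : Type*) [Group N] : Subgroup (Perm N) :=
  Subgroup.normalizer ((leftReg N).range : Set (Perm N))

theorem Hol.apply_mul {N : Type*} [Group N] (h : Hol N) (x y : N) :
    (h : Perm N) (x * y) = (h : Perm N) x * ((h : Perm N) 1)⁻¹ * (h : Perm N) y := by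
  obtain ⟨z, hz⟩ := (h.2 (leftReg N x)).1 ⟨x, rfl⟩
  have key : ∀ w, (h : Perm N) (x * w) = z * (h : Perm N) w := by
    intro w
    have := congrArg (fun p : Perm N => p ((h : Perm N) w)) hz
    simpa [leftReg] using this.symm
  have h1 : (h : Perm N) x = z * (h : Perm N) 1 := by simpa using key 1
  rw [key y, h1]; group

/-- The projection `Hol N = ρ(N) ⋊ Aut N → Aut N`, given by the formula
`h ↦ (η ↦ h(η) * h(1)⁻¹)`; see `Hol.eq_rightReg_mul_aut` and `Hol.aut_unique`. -/
def Hol.aut {N : Type*} [Group N] : Hol N →* MulAut N where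
  toFun h := MulEquiv.mk' ((h : Perm N).trans (Equiv.mulRight ((h : Perm N) 1)⁻¹)) (by
    intro x y
    simp only [Equiv.trans_apply, Equiv.coe_mulRight, Hol.apply_mul h x y]
    group)
  map_one' := by
    ext x
    change x * (1 : N)⁻¹ = x
    simp
  map_mul' g h := by
    ext x
    have e : ((h : Perm N) x * ((h : Perm N) 1)⁻¹) * (h : Perm N) 1 = (h : Perm N) x := by group
    have := Hol.apply_mul g ((h : Perm N) x * ((h : Perm N) 1)⁻¹) ((h : Perm N) 1)
    rw [e] at this
    change (g : Perm N) ((h : Perm N) x) * ((g : Perm N) ((h : Perm N) 1))⁻¹ =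
      (g : Perm N) ((h : Perm N) x * ((h : Perm N) 1)⁻¹) * ((g : Perm N) 1)⁻¹
    simp [this]

theorem Hol.aut_apply {N : Type*} [Group N] (h : Hol N) (η : N) :
    Hol.aut h η = (h : Perm N) η * ((h : Perm N) 1)⁻¹ := rfl

/-- Every element of the holomorph is the product of its `ρ(N)`-part and its `Aut N`-part. -/
theorem Hol.eq_rightReg_mul_aut {N : Type*} [Group N] (h : Hol N) :
    (h : Perm N) = rightReg N ((h : Perm N) 1)⁻¹ * MulAut.toPerm N (Hol.aut h) := by
  ext x
  change (h : Perm N) x = Hol.aut h x * ((h : Perm N) 1)⁻¹⁻¹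
  simp [Hol.aut_apply]

/-- The decomposition `Hol N = ρ(N) ⋊ Aut N` determines the automorphism component. -/
theorem Hol.aut_unique {N : Type*} [Group N] (h : Hol N) (x : N) (φ : MulAut N)
    (hφ : (h : Perm N) = rightReg N x * MulAut.toPerm N φ) : Hol.aut h = φ := by
  have key : ∀ z, (h : Perm N) z = φ z * x⁻¹ := by
    intro z; rw [hφ]; rfl
  ext y
  simp [Hol.aut_apply, key]

namespace RegularStableEmbedding

variable {G : Type*} [Group G] {H : Subgroup G} {N : Type*} [Group N]

theorem bijective_apply_base [Finite (G ⧸ H)] (α : RegularStableEmbedding G H N) :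
    Function.Bijective (fun η : N => α.hom η ((1 : G) : G ⧸ H)) := by
  have hc : Nat.card N = Nat.card (G ⧸ H) := by
    rw [← α.regular.1]
    exact Nat.card_congr (MonoidHom.ofInjective α.injective).toEquiv
  have : Finite N := Nat.finite_of_card_ne_zero (by rw [hc]; exact Nat.card_pos.ne')
  refine Function.Surjective.bijective_of_nat_card_le ?_ hc.le
  intro y
  have := α.regular.2
  obtain ⟨⟨_, η, rfl⟩, hg⟩ := MulAction.exists_smul_eq α.hom.range ((1 : G) : G ⧸ H) y
  exact ⟨η, hg⟩

/-- The bijection `N ≃ G ⧸ H`, `η ↦ α(η)(1·H)`, attached to a regular embedding `α`. -/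
def baseEquiv [Finite (G ⧸ H)] (α : RegularStableEmbedding G H N) : N ≃ G ⧸ H :=
  Equiv.ofBijective _ α.bijective_apply_base

theorem baseEquiv_conj [Finite (G ⧸ H)] (α : RegularStableEmbedding G H N) (η : N) :
    α.baseEquiv.symm.permCongr (α.hom η) = leftReg N η := by
  ext x
  simp only [Equiv.permCongr_apply, Equiv.symm_symm]
  rw [Equiv.symm_apply_eq]
  simp [baseEquiv, leftReg]

theorem translate_mem_hol [Finite (G ⧸ H)] (α : RegularStableEmbedding G H N) (g : G) :
    α.baseEquiv.symm.permCongrHom (cosetTranslation G H g) ∈ Hol N := by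
  have hr : ∀ p : Perm (G ⧸ H), p ∈ (α.hom.range : Set (Perm (G ⧸ H))) ↔
      α.baseEquiv.symm.permCongrHom p ∈ ((leftReg N).range : Set (Perm N)) := by
    intro p
    constructor
    · rintro ⟨η, rfl⟩
      exact ⟨η, (α.baseEquiv_conj η).symm⟩
    · rintro ⟨η, hη⟩
      refine ⟨η, α.baseEquiv.symm.permCongrHom.injective ?_⟩
      rw [← hη]
      exact α.baseEquiv_conj η
  intro p
  obtain ⟨q, rfl⟩ := α.baseEquiv.symm.permCongrHom.surjective p
  rw [← hr, ← map_mul, ← map_inv, ← map_mul, ← hr]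
  exact α.stable ⟨g, rfl⟩ q

/-- Byott's translation: the homomorphism `β : G → Hol N` corresponding to the embedding `α`,
obtained by transporting the left translation action of `G` on `G ⧸ H` to `N` along the
bijection `η ↦ α(η)(1·H)`. -/
def beta [Finite (G ⧸ H)] (α : RegularStableEmbedding G H N) : G →* Hol N :=
  (α.baseEquiv.symm.permCongrHom.toMonoidHom.comp (cosetTranslation G H)).codRestrict (Hol N)
    α.translate_mem_hol

/-- The action of `G` on `N` through the automorphism component of `β`. -/
def autAction [Finite (G ⧸ H)] (α : RegularStableEmbedding G H N) : G →* MulAut N :=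
  Hol.aut.comp α.beta

/-- The action of `G` on the image `α(N)` by `σ ∗ η = λ(σ) η λ(σ)⁻¹`. -/
def conjAction (α : RegularStableEmbedding G H N) : G →* MulAut α.hom.range :=
  α.hom.range.normalizerMonoidHom.comp
    ((cosetTranslation G H).codRestrict _ fun g => α.stable ⟨g, rfl⟩)

end RegularStableEmbedding

/-! ### Fixed points of group algebras -/

/-- For an action `f` of `Gal(E/K)` on the group `M` by automorphisms, the action of `σ` on the
group algebra `E[M]`: as a Galois automorphism on the coefficients and via `f` on `M`. -/
def galAct {K E M : Type*} [Field K] [Field E] [Algebra K E] [Group M]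
    (f : Gal(E/K) →* MulAut M) (σ : Gal(E/K)) : MonoidAlgebra E M →ₐ[K] MonoidAlgebra E M :=
  (MonoidAlgebra.domCongr K E (f σ)).toAlgHom.comp
    (MonoidAlgebra.mapAlgHom M (σ : E →ₐ[K] E))

theorem galAct_single {K E M : Type*} [Field K] [Field E] [Algebra K E] [Group M]
    (f : Gal(E/K) →* MulAut M) (σ : Gal(E/K)) (η : M) (x : E) :
    galAct f σ (MonoidAlgebra.single η x) = MonoidAlgebra.single (f σ η) (σ x) := by
  simp [galAct]

/-- The `K`-algebra `E[M]^G`, `G = Gal(E/K)`, of fixed points of the group algebra. -/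
def fixedPoints {K E M : Type*} [Field K] [Field E] [Algebra K E] [Group M]
    (f : Gal(E/K) →* MulAut M) : Subalgebra K (MonoidAlgebra E M) :=
  ⨅ σ : Gal(E/K), AlgHom.equalizer (galAct f σ) (AlgHom.id K (MonoidAlgebra E M))

theorem mem_fixedPoints {K E M : Type*} [Field K] [Field E] [Algebra K E] [Group M]
    (f : Gal(E/K) →* MulAut M) (x : MonoidAlgebra E M) :
    x ∈ fixedPoints f ↔ ∀ σ : Gal(E/K), galAct f σ x = x := by
  simp [fixedPoints, Algebra.mem_iInf]

/-- The Galois group `Gal(E/L)`, as a subgroup of `Gal(E/K)`, for a tower `E/L/K`. -/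
def galSubgroup (K L E : Type*) [Field K] [Field L] [Field E] [Algebra K L] [Algebra K E]
    [Algebra L E] [IsScalarTower K L E] : Subgroup Gal(E/K) :=
  (IsScalarTower.toAlgHom K L E).fieldRange.fixingSubgroup

/-! ### Dual groups and `Γ`-sets -/

/-- The action of `Γ = Gal(F/K)` on the dual group `N →* Fˣ` dual to an action `f` of `Γ`
on `N`: `(γ ∗ χ)(η) = γ (χ (γ⁻¹ ∗ η))`. -/
def dualAction {K F N : Type*} [Field K] [Field F] [Algebra K F] [Group N]
    (f : Gal(F/K) →* MulAut N) : Gal(F/K) →* Perm (N →* Fˣ) :=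
  MonoidHom.toHomPerm
    { toFun := fun γ χ =>
        ((Units.map ((γ : F →ₐ[K] F) : F →* F)).comp χ).comp (f γ⁻¹).toMonoidHom
      map_one' := by
        funext χ; ext η
        change (1 : Gal(F/K)) (χ (f (1 : Gal(F/K))⁻¹ η) : F) = χ η
        simp
      map_mul' := by
        intro γ δ; funext χ; ext η
        change (γ * δ) (χ (f (γ * δ)⁻¹ η) : F) = γ (δ (χ (f δ⁻¹ (f γ⁻¹ η)) : F))
        simp [mul_inv_rev, map_mul] }

theorem dualAction_apply {K F N : Type*} [Field K] [Field F] [Algebra K F] [Group N]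
    (f : Gal(F/K) →* MulAut N) (γ : Gal(F/K)) (χ : N →* Fˣ) (η : N) :
    (dualAction f γ χ η : F) = γ (χ (f γ⁻¹ η) : F) := rfl

/-- Two `Γ`-sets, given by their action homomorphisms, are isomorphic if there is a
`Γ`-equivariant bijection between them. -/
def IsoAsSets {Γ X Y : Type*} [Group Γ] (a : Γ →* Perm X) (b : Γ →* Perm Y) : Prop :=
  ∃ ψ : X ≃ Y, ∀ (γ : Γ) (x : X), ψ (a γ x) = b γ (ψ x)

end HopfGalois

end

noncomputable section

namespace HopfGalois

open Equiv MonoidAlgebra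

/-! ### Transport of the group along an equivariant isomorphism -/

/-! By Byott's translation the conjugation action on `α(N)` is `autAction` on `N`, so the algebra is
`A = E[N]^G` for that action (`fixedPointsCongr`). The rest is Galois descent over the field `F`,
which contains the values of all characters of `N`.

Every character `χ` gives by evaluation a `K`-algebra map `A → F`. Distinct characters give distinct
maps (`fixedEval_injective`), every map arises so (`fixedEval_surjective`), and composing with `γ`
on `F` matches the dual action (`fixedEval_dualAction`). Thus the `Γ`-set of characters is `Hom_K(A,
F)`, an invariant of `A`.

Conversely, Fourier inversion identifies `A` with the `Γ`-equivariant functions from the dual group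
to `F` (`nonempty_fixedPoints_algEquiv`), so the `Γ`-set determines `A`. -/

theorem galAct_coeff {K E M : Type*} [Field K] [Field E] [Algebra K E] [Group M]
    (f : Gal(E/K) →* MulAut M) (σ : Gal(E/K)) (x : MonoidAlgebra E M) (η : M) :
    (galAct f σ x).coeff η = σ (x.coeff ((f σ)⁻¹ η)) := by
  simp [galAct]

/-- Equivariantly isomorphic groups have isomorphic fixed algebras. -/
def fixedPointsCongr {K E M M' : Type*} [Field K] [Field E] [Algebra K E] [Group M] [Group M']
    (f : Gal(E/K) →* MulAut M) (f' : Gal(E/K) →* MulAut M') (e : M ≃* M')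
    (he : ∀ σ η, e (f σ η) = f' σ (e η)) : fixedPoints f ≃ₐ[K] fixedPoints f' := by
  have key : ∀ σ x, galAct f' σ (domCongr K E e x) = domCongr K E e (galAct f σ x) := by
    intro σ x
    induction x using MonoidAlgebra.induction_linear with
    | zero => simp
    | add x y hx hy => simp only [map_add, hx, hy]
    | single m r => simp [galAct_single, he]
  refine ((domCongr K E e).subalgebraMap (fixedPoints f)).trans
    (Subalgebra.equivOfEq _ _ ?_)
  ext y
  obtain ⟨x, rfl⟩ := (domCongr K E e).surjective y
  rw [Subalgebra.mem_map, mem_fixedPoints]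
  constructor
  · rintro ⟨z, hz, h⟩ σ
    have hzx : z = x := (domCongr K E e).injective h
    subst hzx
    rw [key, (mem_fixedPoints f z).1 hz]
  · intro h
    refine ⟨x, (mem_fixedPoints f x).2 fun σ => (domCongr K E e).injective ?_, rfl⟩
    rw [← key, h]

namespace RegularStableEmbedding

variable {G : Type*} [Group G] {H : Subgroup G} {N : Type*} [Group N]

theorem finite [Finite (G ⧸ H)] (α : RegularStableEmbedding G H N) : Finite N :=
  Finite.of_equiv _ α.baseEquiv.symm

theorem hom_apply_baseEquiv [Finite (G ⧸ H)] (α : RegularStableEmbedding G H N) (η x : N) :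
    α.hom η (α.baseEquiv x) = α.baseEquiv (η * x) := by
  simp [baseEquiv]

/-- The automorphism component of Byott's translation is the conjugation action on `α(N)`. -/
theorem hom_autAction [Finite (G ⧸ H)] (α : RegularStableEmbedding G H N) (g : G) (η : N) :
    α.hom (α.autAction g η) =
      cosetTranslation G H g * α.hom η * (cosetTranslation G H g)⁻¹ := by
  have hβ : ∀ x, α.baseEquiv ((α.beta g : Perm N) x) = cosetTranslation G H g (α.baseEquiv x) := by
    intro x
    simp [beta]
  rw [eq_mul_inv_iff_mul_eq]
  ext y
  obtain ⟨x, rfl⟩ := α.baseEquiv.surjective y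
  -- With `h = β(g)`, the claim becomes `h(ηx) = (h(η) h(1)⁻¹) h(x)`, whose first factor is the
  -- automorphism part applied to `η`.
  rw [Perm.mul_apply, Perm.mul_apply, hom_apply_baseEquiv, ← hβ, ← hβ, hom_apply_baseEquiv,
    Hol.apply_mul]
  rfl

theorem conjAction_ofInjective [Finite (G ⧸ H)] (α : RegularStableEmbedding G H N) (g : G)
    (η : N) : MonoidHom.ofInjective α.injective (α.autAction g η) =
      α.conjAction g (MonoidHom.ofInjective α.injective η) := by
  ext1
  exact α.hom_autAction g η

end RegularStableEmbedding

/-! ### Evaluation of the group algebra at characters -/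

section Characters

variable {K E F N : Type*} [Field K] [Field E] [Field F] [Algebra K E] [Algebra K F] [Algebra E F]
  [IsScalarTower K E F] [CommGroup N]

/-- The homomorphism `E[N] → F` extending a character `N → Fˣ`. -/
def evalChar (E : Type*) [Field E] [Algebra E F] (χ : N →* Fˣ) : MonoidAlgebra E N →ₐ[E] F :=
  MonoidAlgebra.lift E F N ((Units.coeHom F).comp χ)

theorem evalChar_single (χ : N →* Fˣ) (η : N) (e : E) :
    evalChar E χ (single η e) = algebraMap E F e * (χ η : F) := by
  simp [evalChar, Algebra.smul_def]

theorem evalChar_eq_sum [Fintype N] (χ : N →* Fˣ) (x : MonoidAlgebra E N) :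
    evalChar E χ x = ∑ η, algebraMap E F (x.coeff η) * (χ η : F) := by
  induction x using MonoidAlgebra.induction_linear with
  | zero => simp
  | add x y hx hy => simp [hx, hy, add_mul, Finset.sum_add_distrib]
  | single m r =>
    classical
    rw [evalChar_single, Finset.sum_eq_single m] <;> simp +contextual [eq_comm]

/-- The restriction of `evalChar` to the fixed points. -/
def fixedEval (f : Gal(E/K) →* MulAut N) (χ : N →* Fˣ) : fixedPoints f →ₐ[K] F :=
  ((evalChar E χ).restrictScalars K).comp (fixedPoints f).val

theorem fixedEval_apply (f : Gal(E/K) →* MulAut N) (χ : N →* Fˣ) (x : fixedPoints f) :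
    fixedEval f χ x = evalChar E χ (x : MonoidAlgebra E N) := rfl

/-- Traces supply enough explicit fixed points to separate characters. -/
theorem sum_galAct_mem [FiniteDimensional K E] (f : Gal(E/K) →* MulAut N)
    (x : MonoidAlgebra E N) : ∑ σ, galAct f σ x ∈ fixedPoints f := by
  have hmul : ∀ σ τ, galAct f σ (galAct f τ x) = galAct f (σ * τ) x := by
    intro σ τ
    induction x using MonoidAlgebra.induction_linear with
    | zero => simp
    | add x y hx hy => simp only [map_add, hx, hy]
    | single m r => simp [galAct_single]
  rw [mem_fixedPoints]
  intro σ
  simp only [map_sum, hmul]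
  exact Fintype.sum_equiv (Equiv.mulLeft σ) _ _ fun τ => rfl

/-- Distinct characters restrict to distinct homomorphisms on the fixed points. -/
theorem fixedEval_injective [FiniteDimensional K E] (f : Gal(E/K) →* MulAut N) :
    Function.Injective (fixedEval (F := F) f) := by
  intro χ χ' h
  ext η
  let φ : Gal(E/K) → E →* F := fun σ => ((algebraMap E F).comp (σ : E →+* E) : E →+* F)
  have hφ : Function.Injective φ := by
    intro σ τ hst
    ext e
    exact (algebraMap E F).injective (DFunLike.congr_fun hst e)
  have hli := (linearIndependent_monoidHom E F).comp φ hφ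
  rw [Fintype.linearIndependent_iff] at hli
  -- Equality on the trace of `e·η`, for all `e`, is a linear relation among the embeddings `e ↦ σ
  -- e`. Independence kills every coefficient; the one at `σ = 1` is `χ η - χ' η`.
  have := hli (fun σ => (χ (f σ η) : F) - χ' (f σ η)) ?_ 1
  · simpa [sub_eq_zero] using this
  · funext e
    have he := DFunLike.congr_fun h ⟨_, sum_galAct_mem f (single η e)⟩
    simp only [fixedEval_apply, map_sum, galAct_single, evalChar_single] at he
    rw [← sub_eq_zero, ← Finset.sum_sub_distrib] at he
    simp only [Finset.sum_apply, Pi.smul_apply, Function.comp_apply, smul_eq_mul, Pi.zero_apply]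
    rw [← he]
    refine Finset.sum_congr rfl fun σ _ => ?_
    change _ * algebraMap E F (σ e) = _
    ring

/-- An element of the group algebra annihilated by all characters vanishes. -/
theorem eq_zero_of_evalChar_eq_zero [Finite N]
    [HasEnoughRootsOfUnity F (Monoid.exponent N)] (x : MonoidAlgebra E N)
    (hx : ∀ χ : N →* Fˣ, evalChar E χ x = 0) : x = 0 := by
  have := Fintype.ofFinite N
  have hfin : Fintype (N →* Fˣ) := Fintype.ofFinite _
  have hcard := CommGroup.card_monoidHom_of_hasEnoughRootsOfUnity N F
  have hli : LinearIndependent F (fun χ : N →* Fˣ => fun η => (χ η : F)) :=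
    (linearIndependent_monoidHom N F).comp (fun χ : N →* Fˣ => (Units.coeHom F).comp χ)
      fun χ χ' h => by
        ext η
        exact DFunLike.congr_fun h η
  -- There are `|N| = dim (N → F)` characters, so independence makes them a basis.
  have hspan : Submodule.span F (Set.range fun χ : N →* Fˣ => fun η => (χ η : F)) = ⊤ :=
    hli.span_eq_top_of_card_eq_finrank' (by
      rw [Module.finrank_fintype_fun_eq_card, ← Nat.card_eq_fintype_card, hcard,
        Nat.card_eq_fintype_card])
  -- Pairing with the coefficients of `x`; its values on characters are the evaluations of `x`.
  let L : (N → F) →ₗ[F] F := ∑ η, algebraMap E F (x.coeff η) • LinearMap.proj η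
  have hL : L = 0 := by
    refine LinearMap.ext_on hspan ?_
    rintro _ ⟨χ, rfl⟩
    simpa [L, evalChar_eq_sum, Algebra.smul_def] using hx χ
  ext η
  classical
  have := LinearMap.congr_fun hL (Pi.single η 1)
  simpa [L, Pi.single_apply] using this

/-! ### Galois equivariance of evaluation, and descent -/

variable [Normal K E]

/-- The inflation to `Gal(F/K)` of an action of `Gal(E/K)`. -/
abbrev inflate (F : Type*) [Field F] [Algebra K F] [Algebra E F] [IsScalarTower K E F]
    (f : Gal(E/K) →* MulAut N) : Gal(F/K) →* MulAut N :=
  f.comp (AlgEquiv.restrictNormalHom (F := K) (K₁ := F) E)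

theorem algebraMap_restrictNormalHom (γ : Gal(F/K)) (e : E) :
    algebraMap E F (AlgEquiv.restrictNormalHom E γ e) = γ (algebraMap E F e) :=
  AlgEquiv.restrictNormal_commutes γ E e

theorem evalChar_galAct (f : Gal(E/K) →* MulAut N) (γ : Gal(F/K)) (χ : N →* Fˣ)
    (x : MonoidAlgebra E N) :
    evalChar E (dualAction (inflate F f) γ χ) (galAct f (AlgEquiv.restrictNormalHom E γ) x) =
      γ (evalChar E χ x) := by
  induction x using MonoidAlgebra.induction_linear with
  | zero => simp
  | add x y hx hy => simp only [map_add, hx, hy]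
  | single m r =>
    rw [galAct_single, evalChar_single, evalChar_single, dualAction_apply,
      algebraMap_restrictNormalHom, map_mul]
    simp

theorem fixedEval_dualAction (f : Gal(E/K) →* MulAut N) (γ : Gal(F/K)) (χ : N →* Fˣ)
    (x : fixedPoints f) :
    fixedEval f (dualAction (inflate F f) γ χ) x = γ (fixedEval f χ x) := by
  rw [fixedEval_apply, fixedEval_apply, ← evalChar_galAct f, (mem_fixedPoints f _).1 x.2]

/-- The algebra of equivariant functions from a `Gal(F/K)`-set to `F`. -/
def equivariantFunctions {X : Type*} (a : Gal(F/K) →* Perm X) : Subalgebra K (X → F) where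
  carrier := {φ | ∀ γ x, φ (a γ x) = γ (φ x)}
  mul_mem' h h' γ x := by simp [h γ x, h' γ x]
  add_mem' h h' γ x := by simp [h γ x, h' γ x]
  algebraMap_mem' r γ x := by simp

/-- Isomorphic `Gal(F/K)`-sets have isomorphic algebras of equivariant functions. -/
def equivariantFunctionsCongr {X Y : Type*} (a : Gal(F/K) →* Perm X) (b : Gal(F/K) →* Perm Y)
    (ψ : X ≃ Y) (h : ∀ γ x, ψ (a γ x) = b γ (ψ x)) :
    equivariantFunctions b ≃ₐ[K] equivariantFunctions a where
  toFun φ := ⟨fun x => φ.1 (ψ x), fun γ x => by simpa only [h] using φ.2 γ (ψ x)⟩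
  invFun φ := ⟨fun y => φ.1 (ψ.symm y), fun γ y => by
    change φ.1 _ = γ (φ.1 _)
    rw [← φ.2 γ, ← ψ.symm_apply_apply (a γ _), h, Equiv.apply_symm_apply]⟩
  left_inv φ := by ext y; simp
  right_inv φ := by ext x; simp
  map_mul' _ _ := rfl
  map_add' _ _ := rfl
  commutes' _ := rfl

variable [HasEnoughRootsOfUnity F (Monoid.exponent N)]

/-- If `F/K` is Galois then every homomorphism from the fixed algebra to `F` is the evaluation at a
character. -/
theorem fixedEval_surjective [Infinite K] [Finite N] [Normal K F]
    (f : Gal(E/K) →* MulAut N) : Function.Surjective (fixedEval (F := F) f) := by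
  intro p
  have := Fintype.ofFinite N
  have hfin : Fintype (N →* Fˣ) := Fintype.ofFinite _
  have hpt : ∀ x, ∃ χ : N →* Fˣ, p x = fixedEval f χ x := by
    intro x
    -- All evaluations of `x` are roots of `q`, and evaluations separate points, so `q` annihilates
    -- `x` and therefore `p x`.
    let q : Polynomial K := ∏ χ : N →* Fˣ, minpoly K (fixedEval f χ x)
    have hq : Polynomial.aeval x q = 0 := by
      refine Subtype.ext (eq_zero_of_evalChar_eq_zero (F := F) _ fun χ => ?_)
      rw [← fixedEval_apply f χ, ← Polynomial.aeval_algHom_apply, map_prod]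
      exact Finset.prod_eq_zero (Finset.mem_univ χ) (minpoly.aeval _ _)
    have hp : Polynomial.aeval (p x) q = 0 := by
      rw [Polynomial.aeval_algHom_apply, hq, map_zero]
    rw [map_prod, Finset.prod_eq_zero_iff] at hp
    obtain ⟨χ, -, hχ⟩ := hp
    -- Since `F/K` is normal, `p x` is a conjugate of an evaluation of `x`, hence is the evaluation
    -- at a conjugate character.
    obtain ⟨γ, hγ⟩ := minpoly.exists_algEquiv_of_root' (Algebra.IsAlgebraic.isAlgebraic _) hχ
    exact ⟨_, by rw [← hγ, fixedEval_dualAction]⟩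
  -- The character found so far depends on `x`. But a vector space over an infinite field is not a
  -- finite union of proper subspaces, so one character serves for all `x`.
  let V : (N →* Fˣ) → Submodule K (fixedPoints f) := fun χ =>
    LinearMap.ker (p.toLinearMap - (fixedEval f χ).toLinearMap)
  have hV : ⋃ χ, (V χ : Set (fixedPoints f)) = Set.univ := by
    refine Set.eq_univ_of_forall fun x => ?_
    obtain ⟨χ, hχ⟩ := hpt x
    exact Set.mem_iUnion.2 ⟨χ, by simp [V, hχ]⟩
  obtain ⟨χ, hχ⟩ := Subspace.exists_eq_top_of_iUnion_eq_univ hV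
  refine ⟨χ, ?_⟩
  ext x
  have hx : x ∈ V χ := by rw [hχ]; trivial
  exact (sub_eq_zero.1 (LinearMap.mem_ker.1 hx)).symm

/-- The characters of `N` are the homomorphisms from the fixed algebra to `F`. -/
def charEquivAlgHom [Infinite K] [Finite N] [Normal K F] [FiniteDimensional K E]
    (f : Gal(E/K) →* MulAut N) : (N →* Fˣ) ≃ (fixedPoints f →ₐ[K] F) :=
  Equiv.ofBijective (fixedEval f) ⟨fixedEval_injective f, fixedEval_surjective f⟩

theorem charEquivAlgHom_dualAction [Infinite K] [Finite N] [Normal K F] [FiniteDimensional K E]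
    (f : Gal(E/K) →* MulAut N) (γ : Gal(F/K)) (χ : N →* Fˣ) :
    charEquivAlgHom f (dualAction (inflate F f) γ χ) =
      (γ : F →ₐ[K] F).comp (charEquivAlgHom f χ) := by
  ext x
  exact fixedEval_dualAction f γ χ x

theorem isoAsSets_of_fixedPoints_algEquiv [Infinite K] [Finite N] [Normal K F]
    [FiniteDimensional K E] (f₁ f₂ : Gal(E/K) →* MulAut N)
    (θ : fixedPoints f₁ ≃ₐ[K] fixedPoints f₂) :
    IsoAsSets (dualAction (inflate F f₁)) (dualAction (inflate F f₂)) := by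
  refine ⟨(charEquivAlgHom f₁).trans ((θ.arrowCongr AlgEquiv.refl).trans
    (charEquivAlgHom f₂).symm), fun γ χ => ?_⟩
  simp only [Equiv.trans_apply]
  rw [Equiv.symm_apply_eq, charEquivAlgHom_dualAction, charEquivAlgHom_dualAction,
    Equiv.apply_symm_apply]
  rfl

/-- Evaluation at all characters identifies the fixed algebra with the algebra of equivariant
functions on the dual group. -/
theorem nonempty_fixedPoints_algEquiv [CharZero K] [Finite N] [IsGalois K F]
    [FiniteDimensional K F] (f : Gal(E/K) →* MulAut N) :
    Nonempty (fixedPoints f ≃ₐ[K] equivariantFunctions (dualAction (inflate F f))) := by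
  have := Fintype.ofFinite N
  have hfin : Fintype (N →* Fˣ) := Fintype.ofFinite _
  have : CharZero F := charZero_of_injective_algebraMap (algebraMap K F).injective
  let Φ : fixedPoints f →ₐ[K] equivariantFunctions (dualAction (inflate F f)) :=
    (AlgHom.pi (fixedEval f)).codRestrict _ fun x γ χ => fixedEval_dualAction f γ χ x
  have hΦ : ∀ x χ, (Φ x).1 χ = evalChar E χ (x : MonoidAlgebra E N) := fun x χ => rfl
  refine ⟨AlgEquiv.ofBijective Φ ⟨(injective_iff_map_eq_zero Φ).2 fun x hx => ?_, fun φ => ?_⟩⟩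
  · refine Subtype.ext (eq_zero_of_evalChar_eq_zero (F := F) _ fun χ => ?_)
    rw [← hΦ, hx]
    rfl
  -- Fourier inversion: the coefficients that a preimage of `φ` must have.
  let c : N → F := fun η => (Nat.card N : F)⁻¹ * ∑ χ : N →* Fˣ, φ.1 χ * (χ η⁻¹ : F)
  have hc : ∀ (γ : Gal(F/K)) η, γ (c η) = c (inflate F f γ η) := by
    intro γ η
    simp only [c, map_mul, map_inv₀, map_natCast, map_sum]
    congr 1
    -- Reindexing by `χ ↦ γ ∗ χ` turns equivariance of `φ` into that of `c`.
    refine Fintype.sum_equiv (dualAction (inflate F f) γ) _ _ fun χ => ?_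
    rw [φ.2 γ χ, dualAction_apply]
    simp
  have : IsGalois E F := IsGalois.tower_top_of_isGalois K E F
  have : FiniteDimensional E F := FiniteDimensional.right K E F
  have hcE : ∀ η, ∃ e : E, algebraMap E F e = c η := by
    intro η
    refine (IsGalois.mem_range_algebraMap_iff_fixed (F := E) (c η)).2 fun τ => ?_
    -- An element of `Gal(F/E)` acts trivially on `N`, so equivariance of `c` makes `c η` fixed by
    -- it, hence an element of `E`.
    have hτ : AlgEquiv.restrictNormalHom E (τ.restrictScalars K) = 1 := by
      ext e
      refine (algebraMap E F).injective ?_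
      rw [algebraMap_restrictNormalHom]
      exact τ.commutes e
    have := hc (τ.restrictScalars K) η
    rw [inflate, MonoidHom.comp_apply, hτ, map_one] at this
    exact this
  choose d hd using hcE
  let x : MonoidAlgebra E N := .ofCoeff (Finsupp.equivFunOnFinite.symm d)
  have hx : ∀ η, x.coeff η = d η := fun η => rfl
  refine ⟨⟨x, (mem_fixedPoints f x).2 fun σ => ?_⟩, Subtype.ext (funext fun χ => ?_)⟩
  · obtain ⟨γ, rfl⟩ := AlgEquiv.restrictNormalHom_surjective (F := K) (K₁ := E) F σ
    ext η
    refine (algebraMap E F).injective ?_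
    rw [galAct_coeff, algebraMap_restrictNormalHom, hx, hx, hd, hd, hc]
    simp
  · classical
    -- Orthogonality of characters: a nontrivial character sums to zero.
    have horth : ∀ χ' : N →* Fˣ,
        ∑ η, (χ' η⁻¹ : F) * χ η = if χ' = χ then (Nat.card N : F) else 0 := by
      intro χ'
      split_ifs with h
      · subst h
        simp
      · rw [← sum_hom_units_eq_zero ((Units.coeHom F).comp (χ'⁻¹ * χ))]
        · simp
        · contrapose! h
          ext η
          have hη : (((χ' η)⁻¹ * χ η : Fˣ) : F) = 1 := DFunLike.congr_fun h η
          rw [inv_mul_eq_one.1 (Units.ext hη)]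
    rw [hΦ, evalChar_eq_sum]
    simp only [hx, hd, c]
    calc _ = (Nat.card N : F)⁻¹ * ∑ χ' : N →* Fˣ, φ.1 χ' * ∑ η, (χ' η⁻¹ : F) * χ η := by
          simp only [Finset.mul_sum, Finset.sum_mul]
          rw [Finset.sum_comm]
          simp only [mul_assoc]
      _ = φ.1 χ := by
          have : (Nat.card N : F) ≠ 0 := Nat.cast_ne_zero.2 Nat.card_pos.ne'
          simp only [horth, mul_ite, mul_zero, Finset.sum_ite_eq', Finset.mem_univ, if_true]
          field_simp

theorem fixedPoints_algEquiv_iff [CharZero K] [Finite N] [IsGalois K F]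
    [FiniteDimensional K F] [FiniteDimensional K E] (f₁ f₂ : Gal(E/K) →* MulAut N) :
    Nonempty (fixedPoints f₁ ≃ₐ[K] fixedPoints f₂) ↔
      IsoAsSets (dualAction (inflate F f₁)) (dualAction (inflate F f₂)) := by
  refine ⟨fun ⟨θ⟩ => isoAsSets_of_fixedPoints_algEquiv f₁ f₂ θ, fun ⟨ψ, hψ⟩ => ?_⟩
  obtain ⟨e₁⟩ := nonempty_fixedPoints_algEquiv (F := F) f₁
  obtain ⟨e₂⟩ := nonempty_fixedPoints_algEquiv (F := F) f₂
  exact ⟨e₁.trans ((equivariantFunctionsCongr _ _ ψ hψ).symm.trans e₂.symm)⟩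

end Characters

/-- `E` and `K(ζ)` are both finite and normal over `K`, and these properties pass to the compositum.
-/
theorem finiteDimensional_normal_of_fieldRange_sup_adjoin_eq_top {K E F : Type*} [Field K]
    [Field E] [Field F] [Algebra K E] [Algebra K F] [FiniteDimensional K E] [Normal K E]
    (ι : E →ₐ[K] F) {n : ℕ} [NeZero n] {ζ : F} (hζ : IsPrimitiveRoot ζ n)
    (h : ι.fieldRange ⊔ IntermediateField.adjoin K {ζ} = ⊤) :
    FiniteDimensional K F ∧ Normal K F := by
  let e : E ≃ₐ[K] ι.fieldRange := AlgEquiv.ofInjectiveField ι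
  have : FiniteDimensional K ι.fieldRange := e.toLinearEquiv.finiteDimensional
  have : Normal K ι.fieldRange := Normal.of_algEquiv e
  have : FiniteDimensional K (IntermediateField.adjoin K {ζ}) :=
    IntermediateField.adjoin.finiteDimensional ((hζ.isIntegral (NeZero.pos n)).tower_top)
  have hfd := IntermediateField.finiteDimensional_sup ι.fieldRange (IntermediateField.adjoin K {ζ})
  rw [h] at hfd
  have : FiniteDimensional K F := IntermediateField.topEquiv.toLinearEquiv.finiteDimensional
  have := hζ.intermediateField_adjoin_isCyclotomicExtension K
  have : IsGalois K (IntermediateField.adjoin K {ζ}) := IsCyclotomicExtension.isGalois {n} K _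
  have hn := IntermediateField.normal_sup K F ι.fieldRange (IntermediateField.adjoin K {ζ})
  rw [h] at hn
  exact ⟨‹_›, Normal.of_algEquiv IntermediateField.topEquiv⟩

end HopfGalois

end

open HopfGalois in
theorem mainTheorem5
    {K L E F N : Type*} [Field K] [CharZero K] [Field L] [Field E] [Field F]
    [Algebra K L] [Algebra K E] [Algebra L E] [IsScalarTower K L E]
    [Algebra K F] [Algebra E F] [IsScalarTower K E F]
    -- `L/K` is a finite (separable) extension, with Galois closure `E`
    [FiniteDimensional K L] [FiniteDimensional K E] [IsGalois K E] [IsNormalClosure K L E]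
    [CommGroup N]
    -- two embeddings of `N` into `Perm (Gal(E/K) ⧸ Gal(E/L))` with regular `G`-stable image
    (α₁ α₂ : RegularStableEmbedding Gal(E/K) (galSubgroup K L E) N)
    -- `F` is the compositum of `E` and `K(ζ)`, `ζ` a primitive root of unity of order `exp N`
    (ζ : F) (hζ : IsPrimitiveRoot ζ (Monoid.exponent N))
    (hF : (IsScalarTower.toAlgHom K E F).fieldRange ⊔ IntermediateField.adjoin K {ζ} = ⊤) :
    Nonempty (fixedPoints α₁.conjAction ≃ₐ[K] fixedPoints α₂.conjAction) ↔
      IsoAsSets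
        (dualAction (α₁.autAction.comp (AlgEquiv.restrictNormalHom (F := K) (K₁ := F) E)))
        (dualAction (α₂.autAction.comp (AlgEquiv.restrictNormalHom (F := K) (K₁ := F) E))) := by
  have := α₁.finite
  have hn : NeZero (Monoid.exponent N) := ⟨Monoid.exponent_ne_zero_of_finite⟩
  have : HasEnoughRootsOfUnity F (Monoid.exponent N) :=
    ⟨⟨ζ, hζ⟩, rootsOfUnity.isCyclic F (Monoid.exponent N)⟩
  obtain ⟨hfd, hnormal⟩ := finiteDimensional_normal_of_fieldRange_sup_adjoin_eq_top _ hζ hF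
  have : Algebra.IsIntegral K F := .of_finite K F
  -- Separability is automatic in characteristic zero.
  have : IsGalois K F := ⟨⟩
  have e : ∀ α : RegularStableEmbedding Gal(E/K) (galSubgroup K L E) N,
      fixedPoints α.autAction ≃ₐ[K] fixedPoints α.conjAction := fun α =>
    fixedPointsCongr _ _ (MonoidHom.ofInjective α.injective) α.conjAction_ofInjective
  rw [← fixedPoints_algEquiv_iff]
  exact ⟨fun ⟨θ⟩ => ⟨((e α₁).trans θ).trans (e α₂).symm⟩,
    fun ⟨θ⟩ => ⟨((e α₁).symm.trans θ).trans (e α₂)⟩⟩
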